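/- All graphs are finite and simple. A triangulation (resp. quadrangulation) is a simple plane graph in which every face is bounded by a triangle (resp. a 4-cycle). A graph is $\kappa$-connected if it has more than $\kappa$ vertices and stays connected after the deletion of any fewer than $\kappa$ vertices. For a connected graph $G$ of order $n\ge 2$, the remoteness of $G$ is $\rho(G)=\max_{v\in V(G)}\frac{1}{n-1}\sum_{w\in V(G)}d_G(v,w)$, where $d_G$ is the usual graph distance. (a) Let $G$ be a $5$-connected triangulation of order $n$. Then \[ \rho(G)\le \frac{n+4}{10}+\varepsilon_n, \] where $\varepsilon_n=-\frac{3}{5(n-1)}$ if $n\equiv 0\pmod 5$, $\varepsilon_n=-\frac{1}{n-1}$ if $n\equiv 1\pmod 5$, $\varepsilon_n=\frac{2}{5(n-1)}$ if $n\equiv 2\pmod 5$, and $\varepsilon_n=-\frac{2}{5(n-1)}$ if $n\equiv 3,4\pmod 5$. (b) Let $G$ be a $3$-connected quadrangulation of order $n$. Then \[ \rho(G)\le \frac{n+2}{6}+\varepsilon_n, \] where $\varepsilon_n=-\frac{5}{3(n-1)}$ if $n\equiv 0\pmod 3$, $\varepsilon_n=-\frac{1}{n-1}$ if $n\equiv 1\pmod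 3$, and $\varepsilon_n=\frac{1}{3(n-1)}$ if $n\equiv 2\pmod 3$. -/

import Mathlib

universe u

namespace SimpleGraph

variable {V : Type u}

/-- A graph is `k`-connected if it has more than `k` vertices and remains connected after the
deletion of any fewer than `k` vertices. -/
def IsKConnected (G : SimpleGraph V) (k : ℕ) : Prop :=
  k < Nat.card V ∧ ∀ S : Finset V, S.card < k → (G.induce {v | v ∉ S}).Connected

/-- The total distance `σ(v)`: the sum of the distances from `v` to all other vertices. -/
noncomputable def totalDist [Fintype V] (G : SimpleGraph V) (v : V) : ℕ :=
  ∑ w : V, G.dist v w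

/-- The arithmetic mean of the distances from `v` to all other vertices. -/
noncomputable def meanDist [Fintype V] (G : SimpleGraph V) (v : V) : ℝ :=
  (G.totalDist v : ℝ) / ((Fintype.card V : ℝ) - 1)

/-- The remoteness `ρ(G)`: the largest mean distance over all vertices of `G`. -/
noncomputable def remoteness [Fintype V] (G : SimpleGraph V) : ℝ :=
  ⨆ v : V, G.meanDist v

/-- A rotation system of `G`: a cyclic ordering, at every vertex `v`, of the darts (oriented edges)
leaving `v`, given by the permutation `rot` that sends each dart to the next one around its tail.
Rotation systems of a connected graph with at least one edge are the same thing as its cellular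
embeddings in closed oriented surfaces, up to orientation-preserving homeomorphism. -/
structure RotationSystem (G : SimpleGraph V) where
  /-- the next dart in the cyclic order around the tail -/
  rot : Equiv.Perm G.Dart
  rot_fst : ∀ d : G.Dart, (rot d).fst = d.fst
  rot_cyclic : ∀ d e : G.Dart, d.fst = e.fst → rot.SameCycle d e

namespace RotationSystem

variable {G : SimpleGraph V}

/-- The face permutation: having traversed the dart `d` from `u` to `v`, the walk along the
boundary of a face goes on with the dart that follows `(v, u)` in the rotation at `v`. -/
def facePerm (R : G.RotationSystem) : Equiv.Perm G.Dart :=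
  (Function.Involutive.toPerm Dart.symm Dart.symm_involutive).trans R.rot

/-- The faces of the embedding: the cycles of the face permutation. -/
def Face (R : G.RotationSystem) : Type u :=
  Quotient (Equiv.Perm.SameCycle.setoid R.facePerm)

/-- The embedded graph is a (connected) plane graph: the closed surface carrying the embedding
has Euler characteristic `2`, that is, it is the sphere. -/
def IsPlane (R : G.RotationSystem) : Prop :=
  G.Connected ∧
    (Nat.card V : ℤ) - (Nat.card G.edgeSet : ℤ) + (Nat.card R.Face : ℤ) = 2

/-- The boundary walk of the face to the side of the dart `d` is a cycle of length `k`: it closes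
up after `k` steps, and the `k` vertices that it visits are distinct. -/
def FaceIsCycle (R : G.RotationSystem) (k : ℕ) (d : G.Dart) : Prop :=
  (R.facePerm ^ k) d = d ∧
    ∀ i < k, ∀ j < k, ((R.facePerm ^ i) d).fst = ((R.facePerm ^ j) d).fst → i = j

/-- A (simple) triangulation: a plane graph in which every face is a triangle. -/
def IsTriangulation (R : G.RotationSystem) : Prop :=
  R.IsPlane ∧ ∀ d : G.Dart, R.FaceIsCycle 3 d

/-- A (simple) quadrangulation: a plane graph in which every face is a 4-cycle. -/
def IsQuadrangulation (R : G.RotationSystem) : Prop :=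
  R.IsPlane ∧ ∀ d : G.Dart, R.FaceIsCycle 4 d

end RotationSystem

end SimpleGraph

/-- The correction term for 5-connected triangulations of order `n`. -/
noncomputable def epsTri (n : ℕ) : ℝ :=
  if n % 5 = 0 then -(3 / (5 * ((n : ℝ) - 1)))
  else if n % 5 = 1 then -(1 / ((n : ℝ) - 1))
  else if n % 5 = 2 then 2 / (5 * ((n : ℝ) - 1))
  else -(2 / (5 * ((n : ℝ) - 1)))

/-- The correction term for 3-connected quadrangulations of order `n`. -/
noncomputable def epsQuad (n : ℕ) : ℝ :=
  if n % 3 = 0 then -(5 / (3 * ((n : ℝ) - 1)))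
  else if n % 3 = 1 then -(1 / ((n : ℝ) - 1))
  else 1 / (3 * ((n : ℝ) - 1))

namespace Equiv.Perm

/-! Fix `v` and sort the vertices by distance from it. If `N i` vertices lie at distance at least
`i`, the total distance is the sum of the `N i` over `i ≥ 1`, and `N 1 = n - 1`. Every layer
strictly between `v` and the last layer separates, so it has at least `κ` vertices (`κ = 5` or `3`,
`IsKConnected.le_ncard_layer`). This gives the quadratic main term; the exact correction depends on
the shape of the last layers. If the last layer has two or more vertices, the one before it has at
least `κ + 1` (`six_le_ncard_layer`, `four_le_ncard_layer`), and in a quadrangulation the last three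
sizes are never 3, 4, 1 (`ncard_layer_ne_three`).

These exclusions come from planarity. Let `U` be a union of outer layers. Its complement is
connected by geodesics to `v`, whence `e(U) + 1 ≤ |U| + f(U)` (`card_edgesIn_compl_lt`), with `f(U)`
the number of faces spanned by `U`. All faces have the same length, and each vertex on the boundary
of `U` supplies darts in `U` on faces not spanned by `U`. So `U` has too few edges for the minimum
degree that `κ`-connectedness forces.

Planarity enters only through Euler's formula: the inequality for the complement follows from one
for connected sets (`card_add_card_facesIn_le`), which is linear algebra on cochains modulo 2. The
same cochains show that quadrangulations are bipartite. -/

theorem SameCycle.exists_apply_not {α : Type*} [Finite α] {σ : Equiv.Perm α} {x y : α}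
    (h : σ.SameCycle x y) {P : α → Prop} (hx : P x) (hy : ¬ P y) :
    ∃ z, σ.SameCycle x z ∧ P z ∧ ¬ P (σ z) := by
  by_contra! H
  obtain ⟨n, -, rfl⟩ := h.exists_pow_eq'
  have key : ∀ m : ℕ, P ((σ ^ m) x) := by
    intro m
    induction m with
    | zero => simpa using hx
    | succ m ih =>
      rw [pow_succ', mul_apply]
      exact H _ ⟨m, by simp⟩ ih
  exact hy (key n)

end Equiv.Perm

/-! ### Cochains modulo 2 and the Euler characteristic of a vertex set -/

namespace SimpleGraph

open scoped Classical in
/-- The edges with both ends in `X`. -/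
noncomputable def edgesIn {V : Type u} [Fintype V] (G : SimpleGraph V) (X : Set V) :
    Finset (Sym2 V) :=
  {e | e ∈ G.edgeSet ∧ ∀ v ∈ e, v ∈ X}

open scoped Classical in
/-- The darts that lead from `X` to `Y`. -/
noncomputable def dartsBetween {V : Type u} [Fintype V] (G : SimpleGraph V) (X Y : Set V) :
    Finset G.Dart :=
  {d | d.fst ∈ X ∧ d.snd ∈ Y}

namespace RotationSystem

variable {V : Type u} {G : SimpleGraph V} (R : G.RotationSystem)

/-- The face to the side of a dart. -/
def face (d : G.Dart) : R.Face := Quotient.mk _ d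

theorem face_eq_iff {d e : G.Dart} : R.face d = R.face e ↔ R.facePerm.SameCycle d e :=
  Quotient.eq (r := Equiv.Perm.SameCycle.setoid R.facePerm)

theorem face_surjective : Function.Surjective R.face := Quotient.mk_surjective

theorem facePerm_apply (d : G.Dart) : R.facePerm d = R.rot d.symm := rfl

@[simp] theorem facePerm_symm (d : G.Dart) : R.facePerm d.symm = R.rot d := by
  simp [facePerm_apply]

@[simp] theorem facePerm_fst (d : G.Dart) : (R.facePerm d).fst = d.snd := by
  simp [facePerm_apply, R.rot_fst]

@[simp] theorem face_facePerm (d : G.Dart) : R.face (R.facePerm d) = R.face d := by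
  rw [face_eq_iff]
  exact Equiv.Perm.sameCycle_apply_left.2 (Equiv.Perm.SameCycle.refl _ _)

theorem face_rot (d : G.Dart) : R.face (R.rot d) = R.face d.symm := by
  rw [← facePerm_symm, face_facePerm]

instance [Finite V] : Finite R.Face :=
  have : Finite G.Dart := Finite.of_injective _ Dart.toProd_injective
  Finite.of_surjective _ R.face_surjective

noncomputable instance [Finite V] : Fintype R.Face := Fintype.ofFinite _

variable [Fintype V]

open scoped Classical in
/-- The faces all of whose vertices lie in `X`. -/
noncomputable def facesIn (X : Set V) : Finset R.Face :=
  {f | ∀ d, R.face d = f → d.fst ∈ X}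

/-- Invariance under `rot` makes `x` constant around each vertex, and invariance under reversal
carries the value along walks. Applied to faces, this is connectedness of the dual graph. -/
theorem apply_eq_of_invariant {α : Type*} (x : G.Dart → α) (hG : G.Connected)
    (hs : ∀ d, x d.symm = x d) (hr : ∀ d, x (R.rot d) = x d) (d e : G.Dart) : x d = x e := by
  have : Finite G.Dart := Finite.of_injective _ Dart.toProd_injective
  have same : ∀ d e : G.Dart, d.fst = e.fst → x d = x e := by
    intro d e h
    obtain ⟨n, -, rfl⟩ := (R.rot_cyclic d e h).exists_pow_eq'
    clear h
    induction n with
    | zero => rfl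
    | succ n ih => rw [pow_succ', Equiv.Perm.mul_apply, hr, ih]
  have walk : ∀ {u v : V} (p : G.Walk u v) (d e : G.Dart), d.fst = u → e.fst = v → x d = x e := by
    intro u v p
    induction p with
    | nil => intro d e hd he; exact same _ _ (hd.trans he.symm)
    | cons h p ih =>
      intro d e hd he
      rw [same d ⟨(_, _), h⟩ hd, ← hs]
      exact ih _ _ rfl he
  obtain ⟨p⟩ := hG.preconnected d.fst e.fst
  exact walk p d e rfl rfl

/-- The coboundary of a vertex cochain modulo 2. -/
noncomputable def cobdry₀ (V : Type u) : (V → ZMod 2) →ₗ[ZMod 2] (Sym2 V → ZMod 2) where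
  toFun g e := Sym2.lift ⟨fun a b => g a + g b, fun _ _ => add_comm _ _⟩ e
  map_add' g h := by
    ext e
    induction e with | _ a b => simp; ring
  map_smul' c g := by
    ext e
    induction e with | _ a b => simp; ring

open scoped Classical in
/-- The coboundary of an edge cochain modulo 2. -/
noncomputable def cobdry₁ : (Sym2 V → ZMod 2) →ₗ[ZMod 2] (R.Face → ZMod 2) where
  toFun y f := ∑ d : G.Dart, if R.face d = f then y d.edge else 0
  map_add' g h := by
    ext f
    simp [← Finset.sum_add_distrib, ← ite_add_zero]
  map_smul' c g := by
    ext f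
    simp [Finset.mul_sum]

/-- Along a face boundary each visit to a vertex is counted once as the head of a dart and once as
the tail of the next, so the sum is zero modulo 2. -/
theorem cobdry₁_cobdry₀ (g : V → ZMod 2) : R.cobdry₁ (cobdry₀ V g) = 0 := by
  classical
  ext f
  have h1 : ∀ d : G.Dart, (if R.face d = f then cobdry₀ V g d.edge else 0) =
      (if R.face d = f then g d.fst else 0) +
        (fun e => if R.face e = f then g e.fst else 0) (R.facePerm d) := by
    intro d
    have : cobdry₀ V g d.edge = g d.fst + g d.snd := rfl
    simp only [face_facePerm, facePerm_fst, this]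
    split_ifs <;> simp
  change (∑ d : G.Dart, if R.face d = f then cobdry₀ V g d.edge else 0) = 0
  rw [Finset.sum_congr rfl (fun d _ => h1 d), Finset.sum_add_distrib,
    Equiv.sum_comp R.facePerm (fun e => if R.face e = f then g e.fst else 0)]
  exact CharTwo.add_self_eq_zero _

section Cochains

variable (X : Set V) (F : Set R.Face)

/-- The coboundary of vertex cochains on `X`, on the edges inside `X`. -/
noncomputable def relCobdry₀ (G : SimpleGraph V) (X : Set V) :
    (X → ZMod 2) →ₗ[ZMod 2] (G.edgesIn X → ZMod 2) :=
  LinearMap.funLeft _ _ (Subtype.val : G.edgesIn X → Sym2 V) ∘ₗ cobdry₀ V ∘ₗ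
    Function.ExtendByZero.linearMap _ (Subtype.val : X → V)

/-- The coboundary of edge cochains on the edges inside `X`, on the faces in `F`. -/
noncomputable def relCobdry₁ : (G.edgesIn X → ZMod 2) →ₗ[ZMod 2] (F → ZMod 2) :=
  LinearMap.funLeft _ _ (Subtype.val : F → R.Face) ∘ₗ R.cobdry₁ ∘ₗ
    Function.ExtendByZero.linearMap _ (Subtype.val : G.edgesIn X → Sym2 V)

variable {X F}

theorem extendByZero_apply {α : Type*} {S : Set α} (g : S → ZMod 2) {a : α} (h : a ∈ S) :
    Function.ExtendByZero.linearMap (ZMod 2) (Subtype.val : S → α) g a = g ⟨a, h⟩ :=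
  Subtype.val_injective.extend_apply g 0 ⟨a, h⟩

theorem mem_edgesIn_edge {d : G.Dart} : d.edge ∈ G.edgesIn X ↔ d.fst ∈ X ∧ d.snd ∈ X := by
  classical
  have : d.edge = s(d.fst, d.snd) := rfl
  simp [edgesIn, this, d.adj]

theorem relCobdry₀_apply (g : X → ZMod 2) (a b : X) (h : s(a.1, b.1) ∈ G.edgesIn X) :
    relCobdry₀ G X g ⟨_, h⟩ = g a + g b := by
  change Function.ExtendByZero.linearMap (ZMod 2) (Subtype.val : X → V) g a +
    Function.ExtendByZero.linearMap (ZMod 2) (Subtype.val : X → V) g b = _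
  rw [extendByZero_apply, extendByZero_apply]

open scoped Classical in
theorem relCobdry₁_apply (y : G.edgesIn X → ZMod 2) (f : F) :
    R.relCobdry₁ X F y f = ∑ d : G.Dart, if R.face d = f then
      Function.ExtendByZero.linearMap (ZMod 2) (Subtype.val : G.edgesIn X → Sym2 V) y d.edge
      else 0 := by
  classical
  simp only [relCobdry₁, cobdry₁]
  simp [LinearMap.funLeft]

theorem relCobdry₁_comp (hF : ∀ d, R.face d ∈ F → d.fst ∈ X) (g : X → ZMod 2) :
    R.relCobdry₁ X F (relCobdry₀ G X g) = 0 := by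
  classical
  ext f
  rw [relCobdry₁_apply]
  refine Eq.trans ?_ (congrFun (R.cobdry₁_cobdry₀
    (Function.ExtendByZero.linearMap (ZMod 2) (Subtype.val : X → V) g)) f)
  refine Finset.sum_congr rfl fun d _ => ?_
  split_ifs with h
  · have h1 : d.fst ∈ X := hF d (h ▸ f.2)
    have h2 : d.snd ∈ X := by
      have := hF (R.facePerm d) (by rw [face_facePerm, h]; exact f.2)
      simpa using this
    exact extendByZero_apply _ (mem_edgesIn_edge.2 ⟨h1, h2⟩)
  · rfl

/-- A functional vanishing on the range is a weight on `F`. Extended by zero, it takes equal values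
on the two sides of every edge, so it is constant, and it is zero on a face outside `F`. -/
theorem relCobdry₁_surjective (hG : G.Connected) (hF : ∀ d, R.face d ∈ F → d.fst ∈ X)
    (hne : F ≠ Set.univ) : LinearMap.range (R.relCobdry₁ X F) = ⊤ := by
  classical
  by_contra hlt
  obtain ⟨l, hl, hker⟩ := Submodule.exists_le_ker_of_lt_top _ (lt_top_iff_ne_top.2 hlt)
  let x : R.Face → ZMod 2 := fun f => if h : f ∈ F then l (Pi.single ⟨f, h⟩ 1) else 0
  have hlx : ∀ z : F → ZMod 2, l z = ∑ f : F, z f * x f := by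
    intro z
    conv_lhs => rw [pi_eq_sum_univ' z]
    simp only [map_sum, map_smul, smul_eq_mul]
    refine Finset.sum_congr rfl fun f _ => ?_
    simp only [x, f.2, dif_pos]
  have hinv : ∀ d : G.Dart, x (R.face d.symm) = x (R.face d) := by
    intro d
    by_cases hd : d.edge ∈ G.edgesIn X
    · have h0 : l (R.relCobdry₁ X F (Pi.single ⟨_, hd⟩ 1)) = 0 := hker ⟨_, rfl⟩
      have h1 : ∀ e : G.Dart, Function.ExtendByZero.linearMap (ZMod 2)
          (Subtype.val : G.edgesIn X → Sym2 V) (Pi.single ⟨_, hd⟩ 1) e.edge =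
          if e.edge = d.edge then 1 else 0 := by
        intro e
        by_cases he : e.edge ∈ G.edgesIn X
        · refine (extendByZero_apply (S := (G.edgesIn X : Set (Sym2 V))) _ he).trans ?_
          simp [Pi.single_apply]
        · rw [if_neg (fun h : e.edge = d.edge => he (h ▸ hd))]
          refine Function.extend_apply' _ _ _ ?_
          rintro ⟨a, ha⟩
          exact he (ha ▸ a.2)
      have h2 : ∀ e : G.Dart, (∑ f : F, (if R.face e = f then x f else 0)) = x (R.face e) := by
        intro e
        by_cases he : R.face e ∈ F
        · rw [Finset.sum_eq_single ⟨R.face e, he⟩]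
          · simp
          · intro b _ hb
            rw [if_neg]
            intro h
            exact hb (Subtype.ext h.symm)
          · simp
        · rw [Finset.sum_eq_zero]
          · simp [x, he]
          · intro b _
            rw [if_neg]
            intro h
            exact he (h ▸ b.2)
      have h3 : ∑ e : G.Dart, (if e.edge = d.edge then x (R.face e) else 0) = 0 := by
        refine Eq.trans ?_ h0
        rw [hlx]
        simp_rw [relCobdry₁_apply, h1, Finset.sum_mul]
        rw [Finset.sum_comm]
        refine Finset.sum_congr rfl fun e _ => ?_
        by_cases he : e.edge = d.edge
        · simp [he, ← h2]
        · simp [he]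
      rw [← Finset.sum_filter] at h3
      have h4 : Finset.univ.filter (fun e : G.Dart => e.edge = d.edge) = {d, d.symm} := by
        ext e
        simp [dart_edge_eq_iff]
      rw [h4, Finset.sum_pair (Dart.symm_ne d).symm] at h3
      exact (CharTwo.add_eq_zero.1 h3).symm
    · have h1 : R.face d ∉ F := fun h => hd (mem_edgesIn_edge.2 ⟨hF d h, by
        simpa using hF (R.facePerm d) (by rwa [face_facePerm])⟩)
      have h2 : R.face d.symm ∉ F := fun h => hd (mem_edgesIn_edge.2 ⟨by
        simpa [R.rot_fst] using hF (R.facePerm d.symm) (by rwa [face_facePerm]), hF _ h⟩)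
      simp [x, h1, h2]
  obtain ⟨f₀, hf₀⟩ := (Set.ne_univ_iff_exists_notMem F).1 hne
  obtain ⟨d₀, rfl⟩ := R.face_surjective f₀
  have hx : ∀ f, x f = 0 := by
    intro f
    obtain ⟨d, rfl⟩ := R.face_surjective f
    rw [R.apply_eq_of_invariant (fun d => x (R.face d)) hG hinv
      (fun d => by rw [face_rot]; exact hinv d) d d₀]
    simp [x, hf₀]
  exact hl (LinearMap.ext fun z => by simp [hlx, hx])

theorem finrank_ker_relCobdry₀ (hX : (G.induce X).Connected) :
    Module.finrank (ZMod 2) (LinearMap.ker (relCobdry₀ G X)) ≤ 1 := by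
  refine finrank_le_one ⟨fun _ => 1, ?_⟩ ?_
  · rw [LinearMap.mem_ker]
    ext ⟨e, he⟩
    induction e with | _ a b =>
    have h : a ∈ X ∧ b ∈ X := by
      simp [edgesIn] at he
      exact he.2
    rw [relCobdry₀_apply _ ⟨a, h.1⟩ ⟨b, h.2⟩]
    exact CharTwo.add_self_eq_zero _
  · rintro ⟨g, hg⟩
    have hadj : ∀ a b : X, (G.induce X).Adj a b → g a = g b := by
      intro a b h
      have he : s(a.1, b.1) ∈ G.edgesIn X := by
        simp [edgesIn]
        exact h
      have := congrFun hg ⟨_, he⟩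
      rw [relCobdry₀_apply] at this
      exact CharTwo.add_eq_zero.1 this
    have hwalk : ∀ a b : X, (G.induce X).Walk a b → g a = g b := by
      intro a b p
      induction p with
      | nil => rfl
      | cons h p ih => rw [hadj _ _ h, ih]
    obtain ⟨a⟩ := hX.nonempty
    refine ⟨g a, Subtype.ext (funext fun b => ?_)⟩
    obtain ⟨p⟩ := hX.preconnected a b
    simp [hwalk _ _ p]

theorem card_le_finrank_range (hX : (G.induce X).Connected) :
    Nat.card X ≤ Module.finrank (ZMod 2) (LinearMap.range (relCobdry₀ G X)) + 1 := by
  have h1 := LinearMap.finrank_range_add_finrank_ker (relCobdry₀ G X)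
  have h2 := finrank_ker_relCobdry₀ hX
  have h3 : Module.finrank (ZMod 2) (X → ZMod 2) = Nat.card X := by
    classical
    rw [Module.finrank_fintype_fun_eq_card, Nat.card_eq_fintype_card]
  omega

theorem card_faces_add_finrank_ker (hG : G.Connected) (hF : ∀ d, R.face d ∈ F → d.fst ∈ X)
    (hne : F ≠ Set.univ) :
    Nat.card F + Module.finrank (ZMod 2) (LinearMap.ker (R.relCobdry₁ X F)) =
      (G.edgesIn X).card := by
  classical
  have h1 := LinearMap.finrank_range_add_finrank_ker (R.relCobdry₁ X F)
  rw [relCobdry₁_surjective R hG hF hne, finrank_top, Module.finrank_fintype_fun_eq_card,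
    Module.finrank_fintype_fun_eq_card, Fintype.card_coe] at h1
  rwa [Nat.card_eq_fintype_card]

theorem range_le_ker (hF : ∀ d, R.face d ∈ F → d.fst ∈ X) :
    LinearMap.range (relCobdry₀ G X) ≤ LinearMap.ker (R.relCobdry₁ X F) := by
  rintro _ ⟨g, rfl⟩
  exact R.relCobdry₁_comp hF g

/-- A connected vertex set that does not span every face has Euler characteristic at most `1`. -/
theorem card_add_card_facesIn_le (hG : G.Connected) (hX : (G.induce X).Connected)
    (hne : R.facesIn X ≠ Finset.univ) :
    Nat.card X + (R.facesIn X).card ≤ (G.edgesIn X).card + 1 := by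
  have hF : ∀ d, R.face d ∈ (R.facesIn X : Set R.Face) → d.fst ∈ X := by
    intro d hd
    simp only [facesIn, Finset.coe_filter, Set.mem_ofPred_eq] at hd
    exact hd.2 d rfl
  have h1 := R.card_faces_add_finrank_ker hG hF (by simpa using hne)
  have h2 := Submodule.finrank_mono (R.range_le_ker hF)
  -- Now `|X| - 1 ≤ rank δ₀ ≤ dim ker δ₁ = e(X) - f(X)`.
  have h3 := card_le_finrank_range hX
  have h4 : Nat.card (R.facesIn X : Set R.Face) = (R.facesIn X).card := by simp
  omega

end Cochains

end RotationSystem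
end SimpleGraph

/-! ### Edge bounds for vertex sets with connected complement -/

namespace SimpleGraph

namespace RotationSystem

variable {V : Type u} {G : SimpleGraph V} (R : G.RotationSystem) [Fintype V]

open scoped Classical in
theorem card_darts_of_face {k : ℕ} (hk : 0 < k) (hR : ∀ d, R.FaceIsCycle k d) (f : R.Face) :
    (Finset.univ.filter fun d => R.face d = f).card = k := by
  obtain ⟨d₀, rfl⟩ := R.face_surjective f
  have himg : (Finset.univ.filter fun d => R.face d = R.face d₀) =
      (Finset.range k).image fun i => (R.facePerm ^ i) d₀ := by
    ext d
    simp only [Finset.mem_filter, Finset.mem_univ, true_and, Finset.mem_image, Finset.mem_range]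
    rw [eq_comm, face_eq_iff]
    constructor
    · intro h
      obtain ⟨n, -, rfl⟩ := h.exists_pow_eq'
      refine ⟨n % k, Nat.mod_lt _ hk, ?_⟩
      have hp : Function.IsPeriodicPt R.facePerm k d₀ := by
        rw [Function.IsPeriodicPt, Equiv.Perm.iterate_eq_pow]
        exact (hR d₀).1
      simpa [Equiv.Perm.iterate_eq_pow] using hp.iterate_mod_apply n
    · rintro ⟨i, -, rfl⟩
      exact ⟨i, by simp⟩
  rw [himg, Finset.card_image_of_injOn, Finset.card_range]
  intro i hi j hj hij
  simp only [Finset.coe_range, Set.mem_Iio] at hi hj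
  exact (hR d₀).2 i hi j hj (congrArg (fun d : G.Dart => d.fst) hij)

theorem _root_.SimpleGraph.card_edgesIn_univ (G : SimpleGraph V) :
    (G.edgesIn Set.univ).card = Nat.card G.edgeSet := by
  classical
  rw [Nat.card_eq_fintype_card, ← edgeFinset_card]
  congr 1
  ext e
  simp [edgesIn]

/-- On the sphere every 1-cocycle is a coboundary. Faces have even length, so the all-ones cochain
is a cocycle; a primitive of it is a 2-colouring. -/
theorem exists_two_coloring (hR : R.IsQuadrangulation) :
    ∃ g : V → ZMod 2, ∀ a b, G.Adj a b → g a + g b = 1 := by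
  classical
  by_cases hd : Nonempty G.Dart
  swap
  · exact ⟨0, fun a b h => (hd ⟨⟨(a, b), h⟩⟩).elim⟩
  obtain ⟨d₀⟩ := hd
  obtain ⟨⟨hG, hχ⟩, hcyc⟩ := hR
  have hF : ∀ d, R.face d ∈ ({R.face d₀}ᶜ : Set R.Face) → d.fst ∈ (Set.univ : Set V) :=
    fun d _ => Set.mem_univ _
  have h1 := R.card_faces_add_finrank_ker hG hF
    ((Set.ne_univ_iff_exists_notMem _).2 ⟨R.face d₀, by simp⟩)
  have hX : (G.induce Set.univ).Connected := (induceUnivIso G).symm.connected_iff.1 hG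
  have h2 := card_le_finrank_range hX
  have h3 := R.range_le_ker hF
  have h4 : Nat.card ({R.face d₀}ᶜ : Set R.Face) + 1 = Nat.card R.Face := by
    have := Set.ncard_add_ncard_compl ({R.face d₀} : Set R.Face)
    rw [Set.ncard_singleton] at this
    rw [← this, Nat.card_coe_set_eq, add_comm]
  rw [card_edgesIn_univ] at h1
  have h5 : Nat.card (Set.univ : Set V) = Nat.card V := Nat.card_univ
  -- One face is omitted to make `δ₁` surjective. Euler's formula then gives the kernel dimension
  -- `|V| - 1`, which is at most the rank of `δ₀`.
  have h6 := Submodule.eq_of_le_of_finrank_le h3 (by omega)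
  have h7 : (fun _ => 1) ∈ LinearMap.ker (R.relCobdry₁ Set.univ {R.face d₀}ᶜ) := by
    rw [LinearMap.mem_ker]
    ext f
    rw [relCobdry₁_apply]
    have : ∀ d : G.Dart, (Function.ExtendByZero.linearMap (ZMod 2)
        (Subtype.val : G.edgesIn Set.univ → Sym2 V) (fun _ => 1)) d.edge = 1 :=
      fun d => extendByZero_apply (S := (G.edgesIn Set.univ : Set (Sym2 V))) _
        (mem_edgesIn_edge.2 (by simp))
    simp only [this]
    rw [← Finset.sum_filter, Finset.sum_const, R.card_darts_of_face (by norm_num) hcyc]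
    rfl
  rw [← h6] at h7
  obtain ⟨g, hg⟩ := h7
  refine ⟨fun v => g ⟨v, trivial⟩, fun a b hab => ?_⟩
  have he : s(a, b) ∈ G.edgesIn Set.univ := by simpa [edgesIn] using hab
  have := congrFun hg ⟨_, he⟩
  rwa [relCobdry₀_apply g ⟨a, trivial⟩ ⟨b, trivial⟩] at this

theorem _root_.SimpleGraph.card_edgesIn_add_le (G : SimpleGraph V) (A : Set V) :
    (G.edgesIn A).card + (G.edgesIn Aᶜ).card + (G.dartsBetween A Aᶜ).card ≤
      Nat.card G.edgeSet := by
  classical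
  have h0 : ((G.dartsBetween A Aᶜ).image Dart.edge).card = (G.dartsBetween A Aᶜ).card := by
    refine Finset.card_image_of_injOn ?_
    intro d hd e he h
    simp only [dartsBetween, Finset.coe_filter, Set.mem_ofPred_eq] at hd he
    rcases (dart_edge_eq_iff _ _).1 h with h | rfl
    · exact h
    · exact (hd.2.2 he.2.1).elim
  have h1 : Disjoint (G.edgesIn A) (G.edgesIn Aᶜ) := by
    rw [Finset.disjoint_left]
    intro e
    induction e with | _ a b =>
    simp only [edgesIn, Finset.mem_filter, Sym2.mem_iff]
    intro h h'
    exact h'.2.2 a (Or.inl rfl) (h.2.2 a (Or.inl rfl))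
  have h2 : Disjoint (G.edgesIn A ∪ G.edgesIn Aᶜ) ((G.dartsBetween A Aᶜ).image Dart.edge) := by
    rw [Finset.disjoint_right]
    intro e he
    obtain ⟨d, hd, rfl⟩ := Finset.mem_image.1 he
    simp only [dartsBetween, Finset.mem_filter] at hd
    simp only [Finset.mem_union, mem_edgesIn_edge]
    rintro (h | h)
    · exact hd.2.2 h.2
    · exact h.1 hd.2.1
  rw [← h0, ← Finset.card_union_of_disjoint h1, ← Finset.card_union_of_disjoint h2,
    ← card_edgesIn_univ]
  refine Finset.card_le_card fun e he => ?_
  simp only [Finset.mem_union, Finset.mem_image, edgesIn, Finset.mem_filter] at he ⊢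
  refine ⟨Finset.mem_univ _, ?_, fun v _ => trivial⟩
  rcases he with (h | h) | ⟨d, -, rfl⟩
  · exact h.2.1
  · exact h.2.1
  · exact d.edge_mem

/-- A face meeting both `A` and its complement has a boundary dart that leaves `A`, and a dart lies
on only one face. -/
theorem card_face_le (A : Set V) :
    Nat.card R.Face ≤ (R.facesIn A).card + (R.facesIn Aᶜ).card + (G.dartsBetween A Aᶜ).card := by
  classical
  have h : (Finset.univ : Finset R.Face) ⊆
      R.facesIn A ∪ R.facesIn Aᶜ ∪ (G.dartsBetween A Aᶜ).image R.face := by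
    intro f _
    by_contra hf
    simp only [facesIn, dartsBetween, Finset.mem_union, Finset.mem_filter, Finset.mem_univ,
      true_and, Finset.mem_image, not_or] at hf
    obtain ⟨⟨h1, h2⟩, h3⟩ := hf
    push Not at h1 h2
    obtain ⟨d, hd, hdA⟩ := h1
    obtain ⟨e, he, heA⟩ := h2
    rw [Set.mem_compl_iff, not_not] at heA
    have hed : R.facePerm.SameCycle e d := by rw [← face_eq_iff, he, hd]
    obtain ⟨z, hz, hzA, hzA'⟩ := hed.exists_apply_not (P := fun d => d.fst ∈ A) heA hdA
    refine h3 ⟨z, ⟨hzA, by simpa using hzA'⟩, ?_⟩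
    rw [← he, eq_comm, face_eq_iff]
    exact hz
  rw [Nat.card_eq_fintype_card, ← Finset.card_univ]
  refine (Finset.card_le_card h).trans ((Finset.card_union_le _ _).trans ?_)
  exact add_le_add (Finset.card_union_le _ _) Finset.card_image_le

theorem _root_.SimpleGraph.card_dartsBetween_self (G : SimpleGraph V) (X : Set V) :
    (G.dartsBetween X X).card = 2 * (G.edgesIn X).card := by
  classical
  rw [Finset.card_eq_sum_card_fiberwise (f := Dart.edge) (t := G.edgesIn X), mul_comm,
    ← smul_eq_mul]
  · refine Finset.sum_const_nat fun e he => ?_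
    have he' : e ∈ G.edgeSet := (Finset.mem_filter.1 he).2.1
    rw [← G.dart_edge_fiber_card e he']
    congr 1
    ext d
    simp only [Finset.mem_filter, Finset.mem_univ, true_and, and_iff_right_iff_imp]
    rintro rfl
    simpa [dartsBetween] using mem_edgesIn_edge.1 he
  · intro d hd
    exact mem_edgesIn_edge.2 (by simpa [dartsBetween] using hd)

/-- Subtract the Euler inequality for `A` from Euler's formula for the whole graph. Mixed edges and
mixed faces cancel, since the latter are no more numerous. -/
theorem card_edgesIn_compl_lt (hR : R.IsPlane) {A : Set V} (hA : (G.induce A).Connected)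
    (hne : Aᶜ.Nonempty) :
    (G.edgesIn Aᶜ).card + 1 ≤ Aᶜ.ncard + (R.facesIn Aᶜ).card := by
  classical
  obtain ⟨hG, hχ⟩ := hR
  have h1 := G.card_edgesIn_add_le A
  have h2 := R.card_face_le A
  have h3 : R.facesIn A ≠ Finset.univ := by
    obtain ⟨u, hu⟩ := hne
    obtain ⟨a⟩ := hA.nonempty
    have hua : u ≠ a.1 := fun h => hu (h ▸ a.2)
    have : Nontrivial V := ⟨⟨u, a.1, hua⟩⟩
    obtain ⟨w, hw⟩ := hG.preconnected.exists_adj_of_nontrivial u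
    intro h
    have : R.face ⟨(u, w), hw⟩ ∈ R.facesIn A := h ▸ Finset.mem_univ _
    exact hu ((Finset.mem_filter.1 this).2 _ rfl)
  have h4 := R.card_add_card_facesIn_le hG hA h3
  have h5 := Set.ncard_add_ncard_compl A
  rw [Nat.card_coe_set_eq] at h4
  omega

theorem mul_card_facesIn_add_le {k : ℕ} (hk : 0 < k) (hR : ∀ d, R.FaceIsCycle k d) {U : Set V}
    {B : Finset G.Dart} (hB : ∀ d ∈ B, d.fst ∈ U ∧ d.snd ∈ U ∧ R.face d ∉ R.facesIn U) :
    k * (R.facesIn U).card + B.card ≤ (G.dartsBetween U U).card := by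
  classical
  have h1 : (Finset.univ.filter fun d : G.Dart => R.face d ∈ R.facesIn U).card =
      k * (R.facesIn U).card := by
    rw [Finset.card_eq_sum_card_fiberwise (f := R.face) (t := R.facesIn U), mul_comm]
    · refine Finset.sum_const_nat fun f hf => ?_
      rw [← R.card_darts_of_face hk hR f]
      congr 1
      ext d
      simp only [Finset.mem_filter, Finset.mem_univ, true_and, and_iff_right_iff_imp]
      rintro rfl
      exact hf
    · intro d hd
      simpa using hd
  rw [← h1, ← Finset.card_union_of_disjoint]
  · refine Finset.card_le_card fun d hd => ?_
    simp only [Finset.mem_union, dartsBetween, Finset.mem_filter, Finset.mem_univ, true_and] at hd ⊢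
    rcases hd with h | h
    · have h' := (Finset.mem_filter.1 h).2
      refine ⟨h' d rfl, ?_⟩
      simpa using h' (R.facePerm d) (by simp)
    · exact ⟨(hB d h).1, (hB d h).2.1⟩
  · rw [Finset.disjoint_right]
    intro d hd h
    exact (hB d hd).2.2 (Finset.mem_filter.1 h).2

/-- This eliminates `f(U)` from the Euler inequality; doubling replaces edges by darts. -/
theorem card_dartsBetween_compl_le (hP : R.IsPlane) {k : ℕ} (hk : 0 < k)
    (hR : ∀ d, R.FaceIsCycle k d) {U : Set V} (hA : (G.induce Uᶜ).Connected) (hne : U.Nonempty)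
    {B : Finset G.Dart} (hB : ∀ d ∈ B, d.fst ∈ U ∧ d.snd ∈ U ∧ R.face d ∉ R.facesIn U) :
    k * ((G.dartsBetween U U).card + 2) + 2 * B.card ≤
      2 * (G.dartsBetween U U).card + 2 * (k * U.ncard) := by
  have h1 := R.mul_card_facesIn_add_le hk hR hB
  have h2 := R.card_edgesIn_compl_lt hP hA (by simpa using hne)
  rw [compl_compl] at h2
  have h3 := G.card_dartsBetween_self U
  nlinarith [Nat.mul_le_mul_left k h2]

theorem exists_rot_transition {p a q : V} (ha : G.Adj p a) (hq : G.Adj p q) {P : V → Prop}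
    (hPa : P a) (hPq : ¬ P q) :
    ∃ d : G.Dart, d.fst = p ∧ P d.snd ∧ ¬ P (R.rot d).snd := by
  have : Finite G.Dart := Finite.of_injective _ Dart.toProd_injective
  obtain ⟨z, hz, h1, h2⟩ := (R.rot_cyclic ⟨(p, a), ha⟩ ⟨(p, q), hq⟩ rfl).exists_apply_not
    (P := fun d => P d.snd) hPa hPq
  refine ⟨z, ?_, h1, h2⟩
  obtain ⟨n, -, rfl⟩ := hz.exists_pow_eq'
  clear hz h1 h2
  induction n with
  | zero => rfl
  | succ n ih => rw [pow_succ', Equiv.Perm.mul_apply, R.rot_fst, ih]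

variable {U : Set V}

/-- In the rotation at `p`, take a dart into `U` directly after one that leaves `U`: the face
between them contains an end outside `U`. -/
theorem exists_dart_from {p a q : V} (ha : G.Adj p a) (hq : G.Adj p q) (haU : a ∉ U)
    (hqU : q ∈ U) : ∃ d : G.Dart, d.fst = p ∧ d.snd ∈ U ∧ R.face d ∉ R.facesIn U := by
  classical
  obtain ⟨d, h1, h2, h3⟩ := R.exists_rot_transition ha hq (P := fun x => x ∉ U) haU (by simpa)
  refine ⟨R.rot d, by rw [R.rot_fst, h1], by simpa using h3, fun h => ?_⟩
  exact h2 ((Finset.mem_filter.1 h).2 d.symm (R.face_rot d).symm)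

theorem exists_dart_to {p a q : V} (ha : G.Adj p a) (hq : G.Adj p q) (haU : a ∉ U)
    (hqU : q ∈ U) : ∃ d : G.Dart, d.snd = p ∧ d.fst ∈ U ∧ R.face d ∉ R.facesIn U := by
  classical
  obtain ⟨d, h1, h2, h3⟩ := R.exists_rot_transition hq ha (P := fun x => x ∈ U) hqU haU
  refine ⟨d.symm, h1, h2, fun h => h3 ?_⟩
  have := (Finset.mem_filter.1 h).2 (R.facePerm (R.facePerm d.symm)) (by simp [face_rot])
  simpa using this

theorem card_dartsBetween_le_of_boundary (hP : R.IsPlane) {k : ℕ} (hk : 0 < k)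
    (hR : ∀ d, R.FaceIsCycle k d) (hA : (G.induce Uᶜ).Connected) (hne : U.Nonempty)
    {P : Set V} (hPU : P ⊆ U) (hPB : ∀ p ∈ P, (∃ a ∉ U, G.Adj p a) ∧ ∃ q ∈ U, G.Adj p q) :
    k * ((G.dartsBetween U U).card + 2) + 2 * P.ncard ≤
      2 * (G.dartsBetween U U).card + 2 * (k * U.ncard) := by
  classical
  have h : ∀ p : P, ∃ d : G.Dart, d.fst = p ∧ d.snd ∈ U ∧ R.face d ∉ R.facesIn U := by
    rintro ⟨p, hp⟩
    obtain ⟨⟨a, haU, ha⟩, q, hqU, hq⟩ := hPB p hp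
    exact R.exists_dart_from ha hq haU hqU
  choose b hb using h
  have hinj : Function.Injective b := by
    intro p q hpq
    apply Subtype.ext
    rw [← (hb p).1, ← (hb q).1, hpq]
  have h1 := R.card_dartsBetween_compl_le hP hk hR hA hne (B := Finset.univ.image b) (by
    intro d hd
    obtain ⟨p, -, rfl⟩ := Finset.mem_image.1 hd
    exact ⟨(hb p).1 ▸ hPU p.2, (hb p).2⟩)
  rwa [Finset.card_image_of_injective _ hinj, Finset.card_univ, ← Nat.card_eq_fintype_card,
    Nat.card_coe_set_eq] at h1

/-- Each boundary vertex supplies an outgoing and an incoming dart. Independence of `P` keeps a dart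
from serving in both roles, which doubles the gain. -/
theorem card_dartsBetween_le_of_independent_boundary (hP : R.IsPlane) {k : ℕ} (hk : 0 < k)
    (hR : ∀ d, R.FaceIsCycle k d) (hA : (G.induce Uᶜ).Connected) (hne : U.Nonempty)
    {P : Set V} (hPU : P ⊆ U) (hPB : ∀ p ∈ P, (∃ a ∉ U, G.Adj p a) ∧ ∃ q ∈ U, G.Adj p q)
    (hind : ∀ p ∈ P, ∀ q ∈ P, ¬ G.Adj p q) :
    k * ((G.dartsBetween U U).card + 2) + 4 * P.ncard ≤
      2 * (G.dartsBetween U U).card + 2 * (k * U.ncard) := by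
  classical
  have h : ∀ p : P, ∃ d : G.Dart, d.fst = p ∧ d.snd ∈ U ∧ R.face d ∉ R.facesIn U := by
    rintro ⟨p, hp⟩
    obtain ⟨⟨a, haU, ha⟩, q, hqU, hq⟩ := hPB p hp
    exact R.exists_dart_from ha hq haU hqU
  have h' : ∀ p : P, ∃ d : G.Dart, d.snd = p ∧ d.fst ∈ U ∧ R.face d ∉ R.facesIn U := by
    rintro ⟨p, hp⟩
    obtain ⟨⟨a, haU, ha⟩, q, hqU, hq⟩ := hPB p hp
    exact R.exists_dart_to ha hq haU hqU
  choose b hb using h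
  choose c hc using h'
  have hinj : Function.Injective (Sum.elim b c) := by
    rintro (p | p) (q | q) hpq
    · congr 1
      apply Subtype.ext
      rw [← (hb p).1, ← (hb q).1]
      exact congrArg (fun d : G.Dart => d.fst) hpq
    · have hpq : b p = c q := hpq
      have := (b p).adj
      rw [(hb p).1, hpq, (hc q).1] at this
      exact (hind _ p.2 _ q.2 this).elim
    · have hpq : c p = b q := hpq
      have := (b q).adj
      rw [(hb q).1, ← hpq, (hc p).1] at this
      exact (hind _ q.2 _ p.2 this).elim
    · congr 1
      apply Subtype.ext
      rw [← (hc p).1, ← (hc q).1]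
      exact congrArg (fun d : G.Dart => d.snd) hpq
  have h1 := R.card_dartsBetween_compl_le hP hk hR hA hne
    (B := Finset.univ.image (Sum.elim b c)) (by
      intro d hd
      obtain ⟨p | p, -, rfl⟩ := Finset.mem_image.1 hd
      · exact ⟨(hb p).1 ▸ hPU p.2, (hb p).2⟩
      · exact ⟨(hc p).2.1, (hc p).1 ▸ hPU p.2, (hc p).2.2⟩)
  rw [Finset.card_image_of_injective _ hinj, Finset.card_univ, Fintype.card_sum,
    ← Nat.card_eq_fintype_card, Nat.card_coe_set_eq] at h1
  omega

end RotationSystem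

end SimpleGraph

/-! ### Distance layers, connectivity and dart counts -/

namespace SimpleGraph

variable {V : Type u} {G : SimpleGraph V}

section Layers

/-- The set of vertices at distance `i` from `v`. -/
def layer (G : SimpleGraph V) (v : V) (i : ℕ) : Set V := {x | G.dist v x = i}

theorem mem_layer {v x : V} {i : ℕ} : x ∈ G.layer v i ↔ G.dist v x = i := Iff.rfl

theorem Connected.dist_le_succ_of_adj (hG : G.Connected) (v : V) {x y : V} (h : G.Adj x y) :
    G.dist v y ≤ G.dist v x + 1 := by
  have := hG.dist_triangle (u := v) (v := x) (w := y)
  rwa [dist_eq_one_iff_adj.2 h] at this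

theorem Connected.exists_adj_of_dist_eq_succ (hG : G.Connected) {v x : V} {i : ℕ}
    (h : G.dist v x = i + 1) : ∃ y, G.Adj x y ∧ G.dist v y = i := by
  obtain ⟨p, hp⟩ := hG.exists_walk_length_eq_dist x v
  rw [dist_comm, h] at hp
  cases p with
  | nil => simp at hp
  | @cons _ y _ hxy q =>
    refine ⟨y, hxy, ?_⟩
    rw [Walk.length_cons, Nat.add_right_cancel_iff] at hp
    have h1 := dist_le q
    have h2 := hG.dist_le_succ_of_adj v hxy.symm
    rw [dist_comm] at h1
    omega

theorem Connected.induce_connected_of_descent {X : Set V} {v : V} (hv : v ∈ X)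
    (h : ∀ x ∈ X, x ≠ v → ∃ y ∈ X, G.Adj x y ∧ G.dist v y < G.dist v x) :
    (G.induce X).Connected := by
  have key : ∀ n, ∀ x : X, G.dist v x = n → (G.induce X).Reachable x ⟨v, hv⟩ := by
    intro n
    induction n using Nat.strong_induction_on with
    | _ n ih =>
      intro x hx
      by_cases hxv : x.1 = v
      · rw [show x = ⟨v, hv⟩ from Subtype.ext hxv]
      · obtain ⟨y, hy, hxy, hlt⟩ := h x x.2 hxv
        have hadj : (G.induce X).Adj x ⟨y, hy⟩ := hxy
        exact hadj.reachable.trans (ih _ (hx ▸ hlt) ⟨y, hy⟩ rfl)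
  have : Nonempty X := ⟨⟨v, hv⟩⟩
  exact ⟨fun x y => (key _ x rfl).trans (key _ y rfl).symm⟩

theorem IsKConnected.le_card_of_separates {k : ℕ} (hG : G.IsKConnected k) {S : Finset V}
    {Z : Set V} {a b : V} (ha : a ∈ Z) (haS : a ∉ S) (hb : b ∉ Z) (hbS : b ∉ S)
    (h : ∀ x ∈ Z, ∀ y, G.Adj x y → y ∈ Z ∨ y ∈ S) : k ≤ S.card := by
  by_contra! hlt
  obtain ⟨p⟩ := (hG.2 S hlt).preconnected ⟨a, haS⟩ ⟨b, hbS⟩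
  have key : ∀ (x y : {v | v ∉ S}), (G.induce {v | v ∉ S}).Walk x y → x.1 ∈ Z → y.1 ∈ Z := by
    intro x y p
    induction p with
    | nil => exact id
    | @cons x y z hxy p ih =>
      intro hx
      exact ih ((h _ hx _ hxy).resolve_right y.2)
  exact hb (key _ _ p ha)

variable [Fintype V]

theorem IsKConnected.le_ncard_neighborSet {k : ℕ} (hG : G.IsKConnected k) (x : V) :
    k ≤ (G.neighborSet x).ncard := by
  classical
  rw [Set.ncard_eq_toFinset_card']
  by_contra! hlt
  have hcard : (insert x (G.neighborSet x).toFinset).card < (Finset.univ : Finset V).card := by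
    have h1 := Finset.card_insert_le x (G.neighborSet x).toFinset
    have h2 := hG.1
    rw [Nat.card_eq_fintype_card] at h2
    rw [Finset.card_univ]
    omega
  obtain ⟨b, -, hb⟩ := Finset.exists_mem_notMem_of_card_lt_card hcard
  simp only [Finset.mem_insert, not_or] at hb
  have := hG.le_card_of_separates (S := (G.neighborSet x).toFinset) (Z := {x}) (a := x) (b := b)
    rfl (by simp) hb.1 hb.2 (by
      rintro _ rfl y hy
      exact Or.inr (by simpa using hy))
  omega

theorem IsKConnected.le_ncard_layer {k : ℕ} (hG : G.IsKConnected k) (hc : G.Connected) {v b : V}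
    {i : ℕ} (hi : 1 ≤ i) (hb : i < G.dist v b) : k ≤ (G.layer v i).ncard := by
  classical
  rw [Set.ncard_eq_toFinset_card']
  refine hG.le_card_of_separates (Z := {x | G.dist v x < i}) (a := v) (b := b) ?_ ?_ ?_ ?_ ?_
  · simpa using by omega
  · simp only [Set.mem_toFinset, mem_layer, dist_self]
    omega
  · simpa using hb.le
  · simp only [Set.mem_toFinset, mem_layer]
    omega
  · intro x hx y hxy
    have := hc.dist_le_succ_of_adj v hxy
    simp only [Set.mem_toFinset, mem_layer, Set.mem_ofPred_eq] at hx ⊢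
    omega

/-- Without such a neighbour, the layer minus `c` would be a separator of only `k - 1` vertices. -/
theorem IsKConnected.exists_adj_next_layer {k : ℕ} (hG : G.IsKConnected k) (hc : G.Connected)
    {v b c : V} {i : ℕ} (hb : i < G.dist v b) (hk : (G.layer v i).ncard = k)
    (hci : G.dist v c = i) : ∃ y, G.Adj c y ∧ G.dist v y = i + 1 := by
  classical
  by_contra! hno
  rw [Set.ncard_eq_toFinset_card'] at hk
  have hcm : c ∈ (G.layer v i).toFinset := by simpa [mem_layer] using hci
  have h1 := Finset.card_erase_of_mem hcm
  have h2 : 0 < (G.layer v i).toFinset.card := Finset.card_pos.2 ⟨c, hcm⟩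
  have := hG.le_card_of_separates (S := (G.layer v i).toFinset.erase c)
    (Z := {x | G.dist v x < i ∨ x = c}) (a := c) (b := b) (Or.inr rfl) (by simp) (by
      rintro (h | rfl)
      · omega
      · omega) (by
      simp only [Finset.mem_erase, Set.mem_toFinset, mem_layer]
      omega) (by
      intro x hx y hxy
      simp only [Finset.mem_erase, Set.mem_toFinset, mem_layer, Set.mem_ofPred_eq]
      have h3 := hc.dist_le_succ_of_adj v hxy
      by_cases hyc : y = c
      · exact Or.inl (Or.inr hyc)
      rcases hx with hx | rfl
      · have hx : G.dist v x < i := hx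
        rcases lt_or_eq_of_le (show G.dist v y ≤ i by omega) with h | h
        · exact Or.inl (Or.inl h)
        · exact Or.inr ⟨hyc, h⟩
      · have := hno y hxy
        rcases lt_or_eq_of_le (show G.dist v y ≤ i by omega) with h | h
        · exact Or.inl (Or.inl h)
        · exact Or.inr ⟨hyc, h⟩)
  omega

end Layers

section Darts

variable [Fintype V]

theorem mem_dartsBetween {X Y : Set V} {d : G.Dart} :
    d ∈ G.dartsBetween X Y ↔ d.fst ∈ X ∧ d.snd ∈ Y := by
  classical
  simp [dartsBetween]

theorem card_dartsBetween_comm (G : SimpleGraph V) (X Y : Set V) :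
    (G.dartsBetween X Y).card = (G.dartsBetween Y X).card := by
  refine Finset.card_bij' (fun d _ => d.symm) (fun d _ => d.symm) ?_ ?_ ?_ ?_
  · intro d hd
    exact mem_dartsBetween.2 (mem_dartsBetween.1 hd).symm
  · intro d hd
    exact mem_dartsBetween.2 (mem_dartsBetween.1 hd).symm
  · simp
  · simp

theorem card_dartsBetween_union_left (G : SimpleGraph V) {X Y : Set V} (h : Disjoint X Y)
    (Z : Set V) : (G.dartsBetween (X ∪ Y) Z).card =
      (G.dartsBetween X Z).card + (G.dartsBetween Y Z).card := by
  classical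
  rw [← Finset.card_union_of_disjoint]
  · congr 1
    ext d
    simp only [mem_dartsBetween, Finset.mem_union, Set.mem_union]
    tauto
  · rw [Finset.disjoint_left]
    intro d hd hd'
    rw [mem_dartsBetween] at hd hd'
    exact Set.disjoint_left.1 h hd.1 hd'.1

theorem card_dartsBetween_union_right (G : SimpleGraph V) {X Y : Set V} (h : Disjoint X Y)
    (Z : Set V) : (G.dartsBetween Z (X ∪ Y)).card =
      (G.dartsBetween Z X).card + (G.dartsBetween Z Y).card := by
  rw [card_dartsBetween_comm, card_dartsBetween_union_left G h, card_dartsBetween_comm G X,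
    card_dartsBetween_comm G Y]

theorem card_dartsBetween_union_self (G : SimpleGraph V) {X Y : Set V} (h : Disjoint X Y) :
    (G.dartsBetween (X ∪ Y) (X ∪ Y)).card = (G.dartsBetween X X).card +
      2 * (G.dartsBetween X Y).card + (G.dartsBetween Y Y).card := by
  rw [card_dartsBetween_union_left G h, card_dartsBetween_union_right G h,
    card_dartsBetween_union_right G h, card_dartsBetween_comm G Y X]
  omega

theorem mul_ncard_le_card_dartsBetween {X Y : Set V} {m : ℕ}
    (h : ∀ x ∈ X, m ≤ {y ∈ Y | G.Adj x y}.ncard) :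
    m * X.ncard ≤ (G.dartsBetween X Y).card := by
  classical
  rw [Finset.card_eq_sum_card_fiberwise (f := fun d : G.Dart => d.fst) (t := X.toFinset),
    Set.ncard_eq_toFinset_card', mul_comm, ← smul_eq_mul]
  · refine Finset.card_nsmul_le_sum _ _ _ fun x hx => ?_
    refine (h x (by simpa using hx)).trans ?_
    rw [Set.ncard_eq_toFinset_card']
    refine Finset.card_le_card_of_surjOn (fun d : G.Dart => d.snd) ?_
    intro y hy
    simp only [Set.coe_toFinset, Set.mem_ofPred_eq] at hy
    refine ⟨⟨(x, y), hy.2⟩, ?_, rfl⟩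
    simpa [mem_dartsBetween] using ⟨by simpa using hx, hy.1⟩
  · intro d hd
    have := mem_dartsBetween.1 hd
    simpa using this.1

theorem mul_ncard_le_of_neighborSet {X Y : Set V} {m : ℕ}
    (hm : ∀ x ∈ X, m ≤ (G.neighborSet x).ncard) (hY : ∀ x ∈ X, ∀ y, G.Adj x y → y ∈ Y) :
    m * X.ncard ≤ (G.dartsBetween X Y).card := by
  refine mul_ncard_le_card_dartsBetween fun x hx => (hm x hx).trans ?_
  exact Set.ncard_le_ncard (fun y hy => ⟨hY x hx y hy, hy⟩) (Set.toFinite _)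

/-- All darts from `Q` end in `U \ Q`, so they and their reverses are disjoint families inside `U`.
-/
theorem two_mul_ncard_le_card_dartsBetween {Q U : Set V} {m : ℕ} (hQU : Q ⊆ U)
    (hind : ∀ x ∈ Q, ∀ y ∈ Q, ¬ G.Adj x y) (hm : ∀ x ∈ Q, m ≤ (G.neighborSet x).ncard)
    (hU : ∀ x ∈ Q, ∀ y, G.Adj x y → y ∈ U) :
    2 * (m * Q.ncard) ≤ (G.dartsBetween U U).card := by
  have hd : Disjoint Q (U \ Q) := Set.disjoint_sdiff_right
  have h1 := mul_ncard_le_of_neighborSet (Y := U \ Q) hm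
    (fun x hx y hy => ⟨hU x hx y hy, fun h => hind x hx y h hy⟩)
  have h2 := card_dartsBetween_union_self G hd
  rw [Set.union_sdiff_cancel hQU] at h2
  omega

end Darts

namespace RotationSystem

variable (R : G.RotationSystem)

theorem adj_rot_snd {d : G.Dart} (h : R.FaceIsCycle 3 d.symm) : G.Adj (R.rot d).snd d.snd := by
  have h1 : R.facePerm (R.facePerm (R.rot d)) = d.symm := by
    rw [← facePerm_symm]
    exact h.1
  have h2 := (R.facePerm (R.rot d)).adj
  have h3 : (R.facePerm (R.rot d)).snd = d.snd := by
    rw [← facePerm_fst, h1]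
    rfl
  rwa [facePerm_fst, h3] at h2

variable [Fintype V]

variable {R} in
-- Consecutive neighbours around `c` are adjacent, so their distances from `v` differ by at most
-- one. The rotation must therefore meet layer `k` once on the way up and once on the way down; the
-- predecessors differ, hence so do the two neighbours.
theorem IsTriangulation.two_le_adj_in_layer (hR : R.IsTriangulation) {v a c q : V} {k : ℕ}
    (ha : G.Adj c a) (hak : G.dist v a < k) (hq : G.Adj c q)
    (hqk : k < G.dist v q) : 2 ≤ {y ∈ G.layer v k | G.Adj c y}.ncard := by
  have hG := hR.1.1
  obtain ⟨z₁, h1, h2, h3⟩ := R.exists_rot_transition ha hq (P := fun x => G.dist v x < k) hak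
    hqk.not_gt
  obtain ⟨z₂, g1, g2, g3⟩ := R.exists_rot_transition hq ha (P := fun x => k < G.dist v x) hqk
    hak.not_gt
  have h4 := hG.dist_le_succ_of_adj v (R.adj_rot_snd (hR.2 z₁.symm)).symm
  have g4 := hG.dist_le_succ_of_adj v (R.adj_rot_snd (hR.2 z₂.symm))
  have adj : ∀ z : G.Dart, z.fst = c → G.Adj c (R.rot z).snd := by
    intro z hz
    have := (R.rot z).adj
    rwa [R.rot_fst, hz] at this
  have hne : (R.rot z₁).snd ≠ (R.rot z₂).snd := by
    intro h
    have h5 : R.rot z₁ = R.rot z₂ := by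
      apply Dart.ext
      exact Prod.ext (by rw [R.rot_fst, R.rot_fst, h1, g1]) h
    rw [R.rot.injective h5] at h2
    omega
  rw [← Set.ncard_pair hne]
  refine Set.ncard_le_ncard ?_ (Set.toFinite _)
  rintro y (rfl | rfl)
  · exact ⟨by rw [mem_layer]; omega, adj _ h1⟩
  · exact ⟨by rw [mem_layer]; omega, adj _ g1⟩

end RotationSystem

end SimpleGraph

/-! ### Restrictions on the sizes of the last layers -/

namespace SimpleGraph

namespace RotationSystem

variable {V : Type u} {G : SimpleGraph V} {R : G.RotationSystem}

/-- A geodesic step from outside `U` towards `v` cannot enter `U`. Layer `i` itself may be split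
between `U` and its complement. -/
theorem _root_.SimpleGraph.Connected.induce_compl_connected (hG : G.Connected) {U : Set V} {v : V}
    {i : ℕ} (hi : 1 ≤ i) (hU : ∀ x ∈ U, i ≤ G.dist v x) (hU' : ∀ x ∉ U, G.dist v x ≤ i) :
    (G.induce Uᶜ).Connected := by
  refine Connected.induce_connected_of_descent (v := v) (fun h => ?_) ?_
  · have := hU v h
    rw [dist_self] at this
    omega
  · intro x hx hxv
    obtain ⟨j, hj⟩ := Nat.exists_eq_succ_of_ne_zero (hG.pos_dist_of_ne (Ne.symm hxv)).ne'
    obtain ⟨y, hxy, hy⟩ := hG.exists_adj_of_dist_eq_succ hj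
    refine ⟨y, fun h => ?_, hxy, by omega⟩
    have := hU y h
    have := hU' x hx
    omega

variable [Fintype V]

theorem IsTriangulation.one_le_of_dist_le (hR : R.IsTriangulation) (h5 : G.IsKConnected 5)
    {v : V} {k : ℕ} (hk : ∀ x, G.dist v x ≤ k + 1) (hne : (G.layer v (k + 1)).Nonempty) :
    1 ≤ k := by
  by_contra! hk0
  obtain rfl : k = 0 := by omega
  rw [zero_add] at hne hk
  have hG := hR.1.1
  have hlow : ∀ x ∈ G.layer v 1, 4 ≤ {y ∈ G.layer v 1 | G.Adj x y}.ncard := by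
    intro x hx
    have h1 : G.neighborSet x ⊆ insert v {y ∈ G.layer v 1 | G.Adj x y} := by
      intro y hy
      by_cases hyv : y = v
      · exact Or.inl hyv
      · refine Or.inr ⟨?_, hy⟩
        have := hG.pos_dist_of_ne (Ne.symm hyv)
        have := hk y
        rw [mem_layer]
        omega
    have h2 := Set.ncard_le_ncard h1 (Set.toFinite _)
    have h3 := Set.ncard_insert_le v {y ∈ G.layer v 1 | G.Adj x y}
    have h4 := h5.le_ncard_neighborSet x
    omega
  have h1 := mul_ncard_le_card_dartsBetween hlow
  have h2 := R.card_dartsBetween_le_of_boundary hR.1 (by norm_num) hR.2 (U := G.layer v 1)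
    (hG.induce_compl_connected le_rfl (fun x hx => le_of_eq (Eq.symm hx)) (fun x _ => hk x)) hne
    (P := G.layer v 1) subset_rfl (by
      intro p hp
      constructor
      · exact ⟨v, by simp [mem_layer], (dist_eq_one_iff_adj.1 hp).symm⟩
      · have h3 := hlow p hp
        obtain ⟨q, hq⟩ := Set.nonempty_of_ncard_ne_zero
          (s := {y ∈ G.layer v 1 | G.Adj p y}) (by omega)
        exact ⟨q, hq.1, hq.2⟩)
  -- With `D` darts inside layer 1, of size `ℓ`, the outerplanar bound `D + 6 ≤ 4ℓ` contradicts `D ≥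
  -- 4ℓ`.
  omega

theorem IsTriangulation.six_le_ncard_layer (hR : R.IsTriangulation) (h5 : G.IsKConnected 5)
    {v : V} {k : ℕ} (hk : ∀ x, G.dist v x ≤ k + 1) (h2 : 2 ≤ (G.layer v (k + 1)).ncard) :
    6 ≤ (G.layer v k).ncard := by
  by_contra! hlt
  have hG := hR.1.1
  have hne : (G.layer v (k + 1)).Nonempty := Set.nonempty_of_ncard_ne_zero (by omega)
  have hk1 := hR.one_le_of_dist_le h5 hk hne
  obtain ⟨b, hb⟩ := hne
  have hb' : k < G.dist v b := by
    rw [mem_layer] at hb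
    omega
  have hC : (G.layer v k).ncard = 5 := by
    have := h5.le_ncard_layer hG hk1 hb'
    omega
  have hup : ∀ c ∈ G.layer v k, ∃ y, G.Adj c y ∧ G.dist v y = k + 1 :=
    fun c hc => h5.exists_adj_next_layer hG hb' hC hc
  have hdown : ∀ c ∈ G.layer v k, ∃ y, G.Adj c y ∧ G.dist v y < k := by
    intro c hc
    obtain ⟨y, hy, hyk⟩ := hG.exists_adj_of_dist_eq_succ (v := v) (x := c) (i := k - 1) (by
      rw [mem_layer] at hc
      omega)
    exact ⟨y, hy, by omega⟩
  have hdisj : Disjoint (G.layer v k) (G.layer v (k + 1)) := by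
    rw [Set.disjoint_left]
    intro x hx hx'
    rw [mem_layer] at hx hx'
    omega
  have hU : ∀ x, x ∈ G.layer v k ∪ G.layer v (k + 1) ↔ k ≤ G.dist v x := by
    intro x
    have := hk x
    simp only [Set.mem_union, mem_layer]
    omega
  have hcard := Set.ncard_union_eq hdisj
  have hUU := R.card_dartsBetween_le_of_boundary hR.1 (by norm_num) hR.2
    (U := G.layer v k ∪ G.layer v (k + 1))
    (hG.induce_compl_connected hk1 (fun x hx => (hU x).1 hx)
      (fun x hx => by rw [hU] at hx; omega)) ⟨b, Or.inr hb⟩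
    (P := G.layer v k) Set.subset_union_left (by
      intro p hp
      obtain ⟨a, ha, hak⟩ := hdown p hp
      obtain ⟨q, hq, hqk⟩ := hup p hp
      exact ⟨⟨a, by rw [hU]; omega, ha⟩, q, by rw [hU]; omega, hq⟩)
  have hCC : 2 * (G.layer v k).ncard ≤ (G.dartsBetween (G.layer v k) (G.layer v k)).card := by
    refine mul_ncard_le_card_dartsBetween fun c hc => ?_
    obtain ⟨a, ha, hak⟩ := hdown c hc
    obtain ⟨q, hq, hqk⟩ := hup c hc
    exact hR.two_le_adj_in_layer ha hak hq (by omega)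
  have hdeg := mul_ncard_le_of_neighborSet (X := G.layer v (k + 1))
    (Y := G.layer v k ∪ G.layer v (k + 1)) (fun x _ => h5.le_ncard_neighborSet x) (by
      intro x hx y hxy
      have := hG.dist_le_succ_of_adj v hxy.symm
      rw [mem_layer] at hx
      rw [hU]
      omega)
  rw [card_dartsBetween_union_right G hdisj,
    card_dartsBetween_comm G (G.layer v (k + 1)) (G.layer v k)] at hdeg
  have hsum := card_dartsBetween_union_self G hdisj
  -- Isolated vertices of the last layer supply no boundary dart, so the outerplanar bound is
  -- applied to the set `H` of the others.
  have hHH : (G.dartsBetween (G.layer v (k + 1)) (G.layer v (k + 1))).card = 0 ∨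
      (G.dartsBetween (G.layer v (k + 1)) (G.layer v (k + 1))).card + 6 ≤
        4 * (G.layer v (k + 1)).ncard := by
    let H : Set V := {x ∈ G.layer v (k + 1) | ∃ y ∈ G.layer v (k + 1), G.Adj x y}
    have hH : G.dartsBetween (G.layer v (k + 1)) (G.layer v (k + 1)) = G.dartsBetween H H := by
      ext d
      rw [mem_dartsBetween, mem_dartsBetween]
      exact ⟨fun h => ⟨⟨h.1, _, h.2, d.adj⟩, ⟨h.2, _, h.1, d.adj.symm⟩⟩,
        fun h => ⟨h.1.1, h.2.1⟩⟩
    rw [hH]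
    rcases H.eq_empty_or_nonempty with h0 | h0
    · left
      rw [h0, Finset.card_eq_zero, Finset.eq_empty_iff_forall_notMem]
      intro d hd
      exact (mem_dartsBetween.1 hd).1
    · right
      have h1 := R.card_dartsBetween_le_of_boundary hR.1 (by norm_num) hR.2 (U := H)
        (hG.induce_compl_connected (v := v) (i := k + 1) (by omega)
          (fun x hx => le_of_eq (Eq.symm hx.1)) (fun x _ => hk x)) h0
        (P := H) subset_rfl (by
          intro p hp
          constructor
          · obtain ⟨a, ha, hak⟩ := hG.exists_adj_of_dist_eq_succ (v := v) (x := p) hp.1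
            refine ⟨a, fun h => ?_, ha⟩
            have := h.1
            rw [mem_layer] at this
            omega
          · obtain ⟨q, hq, hpq⟩ := hp.2
            exact ⟨q, ⟨hq, p, hp.1, hpq.symm⟩, hpq⟩)
      have h2 : H.ncard ≤ (G.layer v (k + 1)).ncard :=
        Set.ncard_le_ncard (fun x hx => hx.1) (Set.toFinite _)
      omega
  -- Let `ℓ` be the size of the last layer, `L` the number of darts inside it and `D` the number
  -- inside `U`. Then `10 + 10ℓ - L ≤ D ≤ 14 + 6ℓ`, so `4ℓ ≤ 4 + L`. This contradicts `ℓ ≥ 2` if `L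
  -- = 0`, and `L + 6 ≤ 4ℓ` otherwise.
  omega

/-- In a 2-colouring, the colour of a vertex records the parity of its distance from `v`. -/
theorem IsQuadrangulation.dist_ne_of_adj (hR : R.IsQuadrangulation) (v : V) {x y : V}
    (h : G.Adj x y) : G.dist v x ≠ G.dist v y := by
  obtain ⟨g, hg⟩ := R.exists_two_coloring hR
  have hwalk : ∀ {a b : V} (p : G.Walk a b), g b = g a + p.length := by
    intro a b p
    induction p with
    | nil => simp
    | @cons a _ _ h p ih =>
      rw [ih, Walk.length_cons, Nat.cast_add, Nat.cast_one, ← hg _ _ h]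
      linear_combination -CharTwo.add_self_eq_zero (g a)
  have hdist : ∀ b, g b = g v + G.dist v b := by
    intro b
    obtain ⟨p, hp⟩ := hR.1.1.exists_walk_length_eq_dist v b
    rw [hwalk p, hp]
  intro heq
  have := hg x y h
  rw [hdist x, hdist y, heq, CharTwo.add_self_eq_zero] at this
  exact zero_ne_one this

theorem IsQuadrangulation.one_le_of_dist_le (hR : R.IsQuadrangulation) (h3 : G.IsKConnected 3)
    {v : V} {k : ℕ} (hk : ∀ x, G.dist v x ≤ k + 1) (hne : (G.layer v (k + 1)).Nonempty) :
    1 ≤ k := by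
  by_contra! hk0
  obtain rfl : k = 0 := by omega
  obtain ⟨x, hx⟩ := hne
  rw [mem_layer] at hx
  have h1 : G.neighborSet x ⊆ {v} := by
    intro y hy
    have h2 := hR.dist_ne_of_adj v hy
    have h4 := hk y
    exact (hR.1.1.dist_eq_zero_iff.1 (show G.dist v y = 0 by omega)).symm
  have h2 := Set.ncard_le_ncard h1 (Set.toFinite _)
  rw [Set.ncard_singleton] at h2
  have := h3.le_ncard_neighborSet x
  omega

theorem IsQuadrangulation.card_dartsBetween_le (hR : R.IsQuadrangulation)
    (h3 : G.IsKConnected 3) {v b : V} {i : ℕ} (hi : 1 ≤ i) (hb : i < G.dist v b)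
    (hl : (G.layer v i).ncard = 3) {U : Set V} (hU : ∀ x, x ∈ U ↔ i ≤ G.dist v x) :
    (G.dartsBetween U U).card + 10 ≤ 4 * U.ncard := by
  have hG := hR.1.1
  have h1 := R.card_dartsBetween_le_of_independent_boundary hR.1 (by norm_num) hR.2 (U := U)
    (hG.induce_compl_connected hi (fun x hx => (hU x).1 hx)
      (fun x hx => by rw [hU] at hx; omega)) ⟨b, (hU b).2 hb.le⟩
    (P := G.layer v i) (fun x hx => (hU x).2 (ge_of_eq hx)) (by
      intro p hp
      constructor
      · obtain ⟨a, ha, hai⟩ := hG.exists_adj_of_dist_eq_succ (v := v) (x := p) (i := i - 1) (by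
          rw [mem_layer] at hp
          omega)
        exact ⟨a, by rw [hU]; omega, ha⟩
      · obtain ⟨q, hq, hqi⟩ := h3.exists_adj_next_layer hG hb hl hp
        exact ⟨q, by rw [hU]; omega, hq⟩)
    (fun p hp q hq hpq => hR.dist_ne_of_adj v hpq (Eq.trans hp (Eq.symm hq)))
  omega

theorem IsQuadrangulation.four_le_ncard_layer (hR : R.IsQuadrangulation) (h3 : G.IsKConnected 3)
    {v : V} {k : ℕ} (hk : ∀ x, G.dist v x ≤ k + 1) (h2 : 2 ≤ (G.layer v (k + 1)).ncard) :
    4 ≤ (G.layer v k).ncard := by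
  by_contra! hlt
  have hG := hR.1.1
  have hne : (G.layer v (k + 1)).Nonempty := Set.nonempty_of_ncard_ne_zero (by omega)
  have hk1 := hR.one_le_of_dist_le h3 hk hne
  obtain ⟨b, hb⟩ := hne
  rw [mem_layer] at hb
  have hC := h3.le_ncard_layer hG hk1 (show k < G.dist v b by omega)
  have hU : ∀ x, x ∈ G.layer v k ∪ G.layer v (k + 1) ↔ k ≤ G.dist v x := by
    intro x
    have := hk x
    simp only [Set.mem_union, mem_layer]
    omega
  have h4 := hR.card_dartsBetween_le h3 hk1 (show k < G.dist v b by omega) (by omega) hU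
  have h5 := Set.ncard_union_le (G.layer v k) (G.layer v (k + 1))
  have h6 := two_mul_ncard_le_card_dartsBetween (m := 3) (Q := G.layer v (k + 1))
    (U := G.layer v k ∪ G.layer v (k + 1)) Set.subset_union_right
    (fun p hp q hq hpq => hR.dist_ne_of_adj v hpq (Eq.trans hp (Eq.symm hq)))
    (fun x _ => h3.le_ncard_neighborSet x) (by
      intro x hx y hxy
      have := hG.dist_le_succ_of_adj v hxy.symm
      rw [mem_layer] at hx
      rw [hU]
      omega)
  -- For a last layer of size `ℓ` this reads `6ℓ + 10 ≤ 4(3 + ℓ)`, whence `ℓ ≤ 1`.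
  omega

theorem IsQuadrangulation.two_le_of_ncard_layer (hR : R.IsQuadrangulation)
    (h3 : G.IsKConnected 3) {v : V} {k : ℕ} (hk : ∀ x, G.dist v x ≤ k + 1)
    (h1 : (G.layer v (k + 1)).ncard = 1) : 2 ≤ k := by
  by_contra! hlt
  have hG := hR.1.1
  have hk1 := hR.one_le_of_dist_le h3 hk (Set.nonempty_of_ncard_ne_zero (by omega))
  obtain rfl : k = 1 := by omega
  obtain ⟨w, hw⟩ := Set.ncard_eq_one.1 h1
  have hwd : G.dist v w = 1 + 1 := by
    rw [← mem_layer, hw]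
    rfl
  obtain ⟨q, -, hq⟩ := hG.exists_adj_of_dist_eq_succ hwd
  have h2 : G.neighborSet q ⊆ {v, w} := by
    intro y hy
    have h4 := hR.dist_ne_of_adj v hy
    have h5 := hk y
    rcases (show G.dist v y = 0 ∨ G.dist v y = 1 + 1 by omega) with h | h
    · exact Or.inl (hG.dist_eq_zero_iff.1 h).symm
    · rw [← mem_layer, hw] at h
      exact Or.inr h
  have h4 := Set.ncard_le_ncard h2 (Set.toFinite _)
  have h5 := Set.ncard_insert_le v {w}
  rw [Set.ncard_singleton] at h5
  have h6 := h3.le_ncard_neighborSet q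
  omega

theorem IsQuadrangulation.ncard_layer_ne_three (hR : R.IsQuadrangulation)
    (h3 : G.IsKConnected 3) {v : V} {k : ℕ} (hk : ∀ x, G.dist v x ≤ k + 2)
    (h1 : (G.layer v (k + 2)).ncard = 1) (h4 : (G.layer v (k + 1)).ncard = 4) :
    (G.layer v k).ncard ≠ 3 := by
  intro hl
  have hG := hR.1.1
  have hk1 := hR.two_le_of_ncard_layer h3 (k := k + 1) hk h1
  obtain ⟨b, hb⟩ : (G.layer v (k + 2)).Nonempty := Set.nonempty_of_ncard_ne_zero (by omega)
  rw [mem_layer] at hb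
  have hU : ∀ x, x ∈ G.layer v k ∪ G.layer v (k + 1) ∪ G.layer v (k + 2) ↔ k ≤ G.dist v x := by
    intro x
    have := hk x
    simp only [Set.mem_union, mem_layer]
    omega
  have h5 := hR.card_dartsBetween_le h3 (by omega) (show k < G.dist v b by omega) hl hU
  have h6 := Set.ncard_union_le (G.layer v k) (G.layer v (k + 1))
  have h7 := Set.ncard_union_le (G.layer v k ∪ G.layer v (k + 1)) (G.layer v (k + 2))
  have h8 := two_mul_ncard_le_card_dartsBetween (m := 3) (Q := G.layer v (k + 1))
    (U := G.layer v k ∪ G.layer v (k + 1) ∪ G.layer v (k + 2))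
    (fun x hx => Or.inl (Or.inr hx))
    (fun p hp q hq hpq => hR.dist_ne_of_adj v hpq (Eq.trans hp (Eq.symm hq)))
    (fun x _ => h3.le_ncard_neighborSet x) (by
      intro x hx y hxy
      have := hG.dist_le_succ_of_adj v hxy.symm
      rw [mem_layer] at hx
      rw [hU]
      omega)
  -- The eight vertices span at most `4 * 8 - 10 = 22` darts, but the four middle ones alone account
  -- for `24`.
  omega

end RotationSystem

end SimpleGraph

/-! ### Summation over layers and the numerical bounds -/

namespace SimpleGraph

section Counting

variable {V : Type u} [Fintype V] (G : SimpleGraph V) (v : V)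

/-- The number of vertices at distance at least `i` from `v`. -/
noncomputable def numFrom (i : ℕ) : ℕ := {x | i ≤ G.dist v x}.ncard

/-- The sum of `numFrom` over all indices `≥ i`, for `i ≥ 1`. -/
noncomputable def distSumFrom (i : ℕ) : ℕ := ∑ w : V, (G.dist v w + 1 - i)

theorem numFrom_eq (i : ℕ) : G.numFrom v i = (G.layer v i).ncard + G.numFrom v (i + 1) := by
  rw [numFrom, numFrom, ← Set.ncard_union_eq]
  · congr 1
    ext x
    simp only [Set.mem_union, mem_layer, Set.mem_ofPred_eq]
    omega
  · rw [Set.disjoint_left]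
    intro x hx hx'
    rw [mem_layer] at hx
    simp only [Set.mem_ofPred_eq] at hx'
    omega

theorem distSumFrom_eq (i : ℕ) :
    G.distSumFrom v i = G.numFrom v i + G.distSumFrom v (i + 1) := by
  classical
  have h : G.numFrom v i = ∑ w : V, if i ≤ G.dist v w then 1 else 0 := by
    rw [numFrom, Set.ncard_eq_toFinset_card', Finset.sum_boole]
    simp
  rw [h, distSumFrom, distSumFrom, ← Finset.sum_add_distrib]
  refine Finset.sum_congr rfl fun w _ => ?_
  split_ifs <;> omega

theorem distSumFrom_one : G.distSumFrom v 1 = G.totalDist v := by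
  simp [distSumFrom, totalDist]

variable {G v}

theorem numFrom_eq_zero {k : ℕ} (hk : ∀ x, G.dist v x ≤ k) : G.numFrom v (k + 1) = 0 := by
  rw [numFrom, Set.ncard_eq_zero, Set.eq_empty_iff_forall_notMem]
  intro x hx
  have := hk x
  simp only [Set.mem_ofPred_eq] at hx
  omega

theorem distSumFrom_eq_zero {k : ℕ} (hk : ∀ x, G.dist v x ≤ k) :
    G.distSumFrom v (k + 1) = 0 := by
  refine Finset.sum_eq_zero fun x _ => ?_
  have := hk x
  omega

theorem numFrom_one (hG : G.Connected) : G.numFrom v 1 + 1 = Fintype.card V := by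
  have h := numFrom_eq G v 0
  have h0 : G.layer v 0 = {v} := by
    ext x
    rw [mem_layer, hG.dist_eq_zero_iff]
    exact eq_comm
  rw [h0, Set.ncard_singleton, zero_add] at h
  rw [add_comm, ← h, numFrom]
  simp [Set.ncard_univ]

/-- Bounds on `distSumFrom` propagate downwards through layers with at least `κ` vertices. -/
theorem mul_distSumFrom_one_le {F : ℕ → ℤ} {c κ m₀ s : ℕ}
    (hF : ∀ m m', m₀ ≤ m → m + κ ≤ m' → c * m' + F m ≤ F m') (hs : 1 ≤ s)
    (hm : m₀ ≤ G.numFrom v s) (hbase : (c * G.distSumFrom v s : ℤ) ≤ F (G.numFrom v s))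
    (hκ : ∀ i, 1 ≤ i → i < s → κ ≤ (G.layer v i).ncard) :
    (c * G.distSumFrom v 1 : ℤ) ≤ F (G.numFrom v 1) := by
  induction s, hs using Nat.le_induction with
  | base => exact hbase
  | succ s hs ih =>
    have h1 := numFrom_eq G v s
    have h2 := distSumFrom_eq G v s
    have h3 := hκ s hs (Nat.lt_succ_self s)
    refine ih (by omega) ?_ fun i hi his => hκ i hi (by omega)
    -- Adding layer `s` raises the distance sum by `G.numFrom v s`, exactly the increment that `hF`
    -- allows.
    have h4 := hF _ _ hm (show G.numFrom v (s + 1) + κ ≤ G.numFrom v s by omega)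
    rw [h2]
    push_cast
    linarith

end Counting

/-- An upper bound for ten times the total distance of a vertex in a 5-connected triangulation of order
`m + 1`. -/
def triBound (m : ℕ) : ℤ :=
  m * (m + 5) + if m % 5 = 0 then -10 else if m % 5 = 1 then 4 else if m % 5 = 4 then -6 else -4

/-- An upper bound for six times the total distance of a vertex in a 3-connected quadrangulation of order
`m + 1`. -/
def quadBound (m : ℕ) : ℤ :=
  m * (m + 3) + if m % 3 = 0 then -6 else if m % 3 = 1 then 2 else -10

theorem triBound_monotone : Monotone triBound := by
  refine monotone_nat_of_le_succ fun m => ?_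
  unfold triBound
  push_cast
  split_ifs <;> first | (exfalso; omega) | (ring_nf; omega)

/-- A layer of exactly 5 gives equality, as the correction has period 5; larger layers are covered
by monotonicity. -/
theorem mul_add_triBound_le {m m' : ℕ} (h : m + 5 ≤ m') :
    10 * (m' : ℤ) + triBound m ≤ triBound m' := by
  obtain ⟨r, rfl⟩ := Nat.exists_eq_add_of_le' h
  refine (add_le_add_right (triBound_monotone (show m ≤ r + m by omega)) _).trans (le_of_eq ?_)
  have : (r + (m + 5)) % 5 = (r + m) % 5 := by omega
  unfold triBound
  rw [this]
  push_cast
  ring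

/-- Some lower bound on `m` is needed: `quadBound 1 = 6` exceeds `quadBound 2 = 0`. -/
theorem quadBound_le_quadBound {m m' : ℕ} (h3 : 3 ≤ m) (h : m ≤ m') :
    quadBound m ≤ quadBound m' := by
  induction m', h using Nat.le_induction with
  | base => exact le_rfl
  | succ n hn ih =>
    refine ih.trans ?_
    unfold quadBound
    push_cast
    split_ifs <;> first | (exfalso; omega) | (ring_nf; omega)

theorem mul_add_quadBound_le {m m' : ℕ} (h3 : 3 ≤ m) (h : m + 3 ≤ m') :
    6 * (m' : ℤ) + quadBound m ≤ quadBound m' := by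
  obtain ⟨r, rfl⟩ := Nat.exists_eq_add_of_le' h
  refine (add_le_add_right (quadBound_le_quadBound h3 (show m ≤ r + m by omega)) _).trans
    (le_of_eq ?_)
  have : (r + (m + 3)) % 3 = (r + m) % 3 := by omega
  unfold quadBound
  rw [this]
  push_cast
  ring

/-- The case of a single last vertex, with distance sum `m + 1` over the last two layers. Equality
at `m = 6, 7` (sizes 5, 1 and 6, 1) fixes two of the residues of `triBound`. -/
theorem le_triBound_of_six_le {m : ℕ} (h : 6 ≤ m) : 10 * ((m : ℤ) + 1) ≤ triBound m := by
  obtain ⟨r, rfl⟩ := Nat.exists_eq_add_of_le' h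
  unfold triBound
  push_cast
  rcases r with _ | _ | r
  · norm_num
  · norm_num
  · split_ifs <;> push_cast <;> nlinarith

/-- With at least 6 vertices in the penultimate layer the sum is at most `2m - 6`. Equality at `m =
8, 9, 10` fixes the other residues. -/
theorem le_triBound_of_eight_le {m : ℕ} (h : 8 ≤ m) : 10 * (2 * (m : ℤ) - 6) ≤ triBound m := by
  obtain ⟨r, rfl⟩ := Nat.exists_eq_add_of_le' h
  unfold triBound
  push_cast
  rcases r with _ | _ | r
  · norm_num
  · norm_num
  · split_ifs <;> push_cast <;> nlinarith

theorem le_quadBound_of_six_le {m : ℕ} (h : 6 ≤ m) :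
    6 * ((m : ℤ) + 1) ≤ quadBound m ∧ 6 * (2 * (m : ℤ) - 4) ≤ quadBound m := by
  obtain ⟨r, rfl⟩ := Nat.exists_eq_add_of_le' h
  unfold quadBound
  push_cast
  rcases r with _ | r
  · norm_num
  · constructor <;> split_ifs <;> push_cast <;> nlinarith

/-- For final sizes `a`, 4, 1 the distance sum is `m + 5 + 1`, and `a ≥ 4` gives `m ≥ 9`. -/
theorem le_quadBound_of_nine_le {m : ℕ} (h : 9 ≤ m) : 6 * ((m : ℤ) + 6) ≤ quadBound m := by
  obtain ⟨r, rfl⟩ := Nat.exists_eq_add_of_le' h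
  unfold quadBound
  push_cast
  split_ifs <;> nlinarith

/-! ### The bounds on total distance and remoteness -/

section Bounds

variable {V : Type u} [Fintype V] {G : SimpleGraph V} {R : G.RotationSystem}

theorem Connected.exists_max_dist (hG : G.Connected) [Nontrivial V] (v : V) :
    ∃ k, (∀ x, G.dist v x ≤ k + 1) ∧ ∃ b, G.dist v b = k + 1 := by
  obtain ⟨b, hb⟩ := Finite.exists_max fun x => G.dist v x
  obtain ⟨w, hw⟩ := exists_ne v
  have h1 := hG.pos_dist_of_ne hw.symm
  have h2 := hb w
  obtain ⟨k, hk⟩ := Nat.exists_eq_succ_of_ne_zero (show G.dist v b ≠ 0 by omega)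
  exact ⟨k, fun x => (hb x).trans hk.le, b, hk⟩

theorem RotationSystem.IsTriangulation.totalDist_le (hR : R.IsTriangulation)
    (h5 : G.IsKConnected 5) [Nontrivial V] (v : V) :
    10 * (G.totalDist v : ℤ) ≤ triBound (Fintype.card V - 1) := by
  have hG := hR.1.1
  obtain ⟨k, hk, b, hb⟩ := hG.exists_max_dist v
  have hne : (G.layer v (k + 1)).Nonempty := ⟨b, hb⟩
  have hk1 := hR.one_le_of_dist_le h5 hk hne
  have hpos := (Set.ncard_pos (Set.toFinite _)).2 hne
  have hlay : ∀ i, 1 ≤ i → i ≤ k → 5 ≤ (G.layer v i).ncard :=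
    fun i hi hik => h5.le_ncard_layer hG hi (by rw [hb]; omega)
  have hlast := hR.six_le_ncard_layer h5 hk
  have e1 := numFrom_eq G v k
  have e2 := numFrom_eq G v (k + 1)
  have e3 := distSumFrom_eq G v k
  have e4 := distSumFrom_eq G v (k + 1)
  have e5 := numFrom_eq_zero hk
  have e6 := distSumFrom_eq_zero hk
  have h5k := hlay k hk1 le_rfl
  rw [← distSumFrom_one, ← numFrom_one (v := v) hG, Nat.add_sub_cancel]
  refine mul_distSumFrom_one_le (c := 10) (κ := 5) (m₀ := 0) (s := k)
    (fun m m' _ h => mul_add_triBound_le h) hk1 (Nat.zero_le _) ?_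
    fun i hi his => hlay i hi his.le
  rcases Nat.lt_or_ge (G.layer v (k + 1)).ncard 2 with h | h
  · refine le_trans ?_ (le_triBound_of_six_le (m := G.numFrom v k) (by omega))
    push_cast
    omega
  · have := hlast h
    refine le_trans ?_ (le_triBound_of_eight_le (m := G.numFrom v k) (by omega))
    push_cast
    omega

theorem RotationSystem.IsQuadrangulation.totalDist_le (hR : R.IsQuadrangulation)
    (h3 : G.IsKConnected 3) [Nontrivial V] (v : V) :
    6 * (G.totalDist v : ℤ) ≤ quadBound (Fintype.card V - 1) := by
  have hG := hR.1.1
  obtain ⟨k, hk, b, hb⟩ := hG.exists_max_dist v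
  have hne : (G.layer v (k + 1)).Nonempty := ⟨b, hb⟩
  have hk1 := hR.one_le_of_dist_le h3 hk hne
  have hpos := (Set.ncard_pos (Set.toFinite _)).2 hne
  have hlay : ∀ i, 1 ≤ i → i ≤ k → 3 ≤ (G.layer v i).ncard :=
    fun i hi hik => h3.le_ncard_layer hG hi (by rw [hb]; omega)
  have hlast := hR.four_le_ncard_layer h3 hk
  have e1 := numFrom_eq G v k
  have e2 := numFrom_eq G v (k + 1)
  have e3 := distSumFrom_eq G v k
  have e4 := distSumFrom_eq G v (k + 1)
  have e5 := numFrom_eq_zero hk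
  have e6 := distSumFrom_eq_zero hk
  have h3k := hlay k hk1 le_rfl
  rw [← distSumFrom_one, ← numFrom_one (v := v) hG, Nat.add_sub_cancel]
  -- Final sizes 4, 1 violate the bound as a base case: `6 * 6 > quadBound 5 = 30`. The induction
  -- then starts one layer earlier, where size 3 is excluded.
  by_cases hex : (G.layer v (k + 1)).ncard = 1 ∧ (G.layer v k).ncard = 4
  · obtain ⟨j, rfl⟩ : ∃ j, k = j + 1 := ⟨k - 1, by omega⟩
    have hk2 := hR.two_le_of_ncard_layer h3 hk hex.1
    have hj := hlay j (by omega) (by omega)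
    have hj3 := hR.ncard_layer_ne_three h3 hk hex.1 hex.2
    have e7 := numFrom_eq G v j
    have e8 := distSumFrom_eq G v j
    refine mul_distSumFrom_one_le (c := 6) (κ := 3) (m₀ := 3) (s := j)
      (fun m m' h0 h => mul_add_quadBound_le h0 h) (by omega) (by omega) ?_
      fun i hi his => hlay i hi (by omega)
    refine le_trans ?_ (le_quadBound_of_nine_le (m := G.numFrom v j) (by omega))
    push_cast
    omega
  · refine mul_distSumFrom_one_le (c := 6) (κ := 3) (m₀ := 3) (s := k)
      (fun m m' h0 h => mul_add_quadBound_le h0 h) hk1 (by omega) ?_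
      fun i hi his => hlay i hi his.le
    rcases Nat.lt_or_ge (G.layer v (k + 1)).ncard 2 with h | h
    · rcases Nat.lt_or_ge (G.layer v k).ncard 4 with h' | h'
      · rw [show G.numFrom v k = 4 by omega, show G.distSumFrom v k = 5 by omega]
        decide
      · refine le_trans ?_ (le_quadBound_of_six_le (m := G.numFrom v k) (by omega)).1
        push_cast
        omega
    · have := hlast h
      refine le_trans ?_ (le_quadBound_of_six_le (m := G.numFrom v k) (by omega)).2
      push_cast
      omega

end Bounds

theorem triBound_div {n : ℕ} (hn : 2 ≤ n) :
    (triBound (n - 1) : ℝ) / 10 / ((n : ℝ) - 1) = ((n : ℝ) + 4) / 10 + epsTri n := by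
  obtain ⟨m, rfl⟩ := Nat.exists_eq_add_of_le' hn
  have h : ((m : ℝ) + 1) ≠ 0 := by positivity
  have h' : ((m + 2 : ℕ) : ℝ) - 1 = m + 1 := by push_cast; ring
  unfold triBound epsTri
  rw [h', show m + 2 - 1 = m + 1 by omega]
  push_cast
  split_ifs <;> first | (exfalso; omega) | (field_simp; ring)

theorem quadBound_div {n : ℕ} (hn : 2 ≤ n) :
    (quadBound (n - 1) : ℝ) / 6 / ((n : ℝ) - 1) = ((n : ℝ) + 2) / 6 + epsQuad n := by
  obtain ⟨m, rfl⟩ := Nat.exists_eq_add_of_le' hn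
  have h : ((m : ℝ) + 1) ≠ 0 := by positivity
  have h' : ((m + 2 : ℕ) : ℝ) - 1 = m + 1 := by push_cast; ring
  unfold quadBound epsQuad
  rw [h', show m + 2 - 1 = m + 1 by omega]
  push_cast
  split_ifs <;> first | (exfalso; omega) | (field_simp; ring)

theorem remoteness_le_of_totalDist_le {V : Type u} [Fintype V] [Nontrivial V] (G : SimpleGraph V)
    {b : ℤ} {c : ℕ} (hc : 0 < c) (h : ∀ v, c * (G.totalDist v : ℤ) ≤ b) :
    G.remoteness ≤ (b : ℝ) / c / ((Fintype.card V : ℝ) - 1) := by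
  have hV : (1 : ℝ) < Fintype.card V := by exact_mod_cast Fintype.one_lt_card
  have hc' : (0 : ℝ) < c := by exact_mod_cast hc
  refine ciSup_le fun v => ?_
  refine div_le_div_of_nonneg_right ?_ (sub_nonneg.2 hV.le)
  rw [le_div_iff₀ hc', mul_comm]
  exact_mod_cast h v

end SimpleGraph

theorem mainTheorem3 {V : Type u} [Fintype V] (G : SimpleGraph V) (R : G.RotationSystem)
    (n : ℕ) (hn : Fintype.card V = n) :
    (R.IsTriangulation → G.IsKConnected 5 →
      G.remoteness ≤ ((n : ℝ) + 4) / 10 + epsTri n) ∧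
    (R.IsQuadrangulation → G.IsKConnected 3 →
      G.remoteness ≤ ((n : ℝ) + 2) / 6 + epsQuad n) := by
  subst hn
  constructor
  · intro hR h5
    have h1 := h5.1
    rw [Nat.card_eq_fintype_card] at h1
    have : Nontrivial V := Fintype.one_lt_card_iff_nontrivial.1 (by omega)
    rw [← SimpleGraph.triBound_div (by omega)]
    exact_mod_cast G.remoteness_le_of_totalDist_le (c := 10) (by norm_num)
      (fun v => hR.totalDist_le h5 v)
  · intro hR h3
    have h1 := h3.1
    rw [Nat.card_eq_fintype_card] at h1
    have : Nontrivial V := Fintype.one_lt_card_iff_nontrivial.1 (by omega)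
    rw [← SimpleGraph.quadBound_div (by omega)]
    exact_mod_cast G.remoteness_le_of_totalDist_le (c := 6) (by norm_num)
      (fun v => hR.totalDist_le h3 v)
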